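/- Let $\mathbb H$ be a complex separable Hilbert space. A spectral measure on the Borel sets of $\mathbb C$ is a map $\mathbf E$ from the Borel sets to the bounded (not necessarily orthogonal) projections of $\mathbb H$ with $\mathbf E(\emptyset)=0$, $\mathbf E(\mathbb C)=I$, $\mathbf E(\mathbb C\setminus A)=I-\mathbf E(A)$, $\mathbf E(A\cap B)=\mathbf E(A)\mathbf E(B)$, $\mathbf E(A\cup B)=\mathbf E(A)+\mathbf E(B)-\mathbf E(A)\mathbf E(B)$, countably additive in the strong operator topology. A densely defined closed operator $T$ in $\mathbb H$ is a spectral operator of scalar type if there is such an $\mathbf E$ so that, with $T_n=\int_{\{|z|\le n\}} z\,\mathbf E(dz)$, the domain of $T$ is $\{x\in\mathbb H:\lim_n T_nx \text{ exists}\}$ and $Tx=\lim_n T_nx$ for every $x$ in the domain. A bounded spectral operator $U$ of scalar type on $\mathbb H$ is called para-unitary if $|\lambda|=1$ for all $\lambda$ in its spectrum $\sigma(U)$. A metric operator is a bounded self-adjoint operator $G$ on $\mathbb H$ that is strictly positive ($\langle x,Gx\rangle>0$ for all $x\neq0$) and has a bounded inverse. Proposition. Let $U$ be a bounded spectral operator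 of scalar type on $\mathbb H$. Then $U$ is para-unitary if and only if there exists a metric operator $G$ such that $G^{1/2}UG^{-1/2}$ is unitary. -/

import Mathlib

open scoped InnerProductSpace

namespace ParaUnitary

/-- A spectral measure on the measurable space `Ω` with values in the bounded, not necessarily
orthogonal, projections of `H`. Only the values on measurable sets are meaningful. -/
structure SpectralMeasure (Ω : Type*) [MeasurableSpace Ω] (H : Type*) [NormedAddCommGroup H]
    [InnerProductSpace ℂ H] where
  toFun : Set Ω → H →L[ℂ] H
  isIdempotentElem : ∀ A, MeasurableSet A → IsIdempotentElem (toFun A)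
  empty : toFun ∅ = 0
  univ : toFun Set.univ = 1
  compl : ∀ A, MeasurableSet A → toFun Aᶜ = 1 - toFun A
  inter : ∀ A B, MeasurableSet A → MeasurableSet B → toFun (A ∩ B) = toFun A * toFun B
  union : ∀ A B, MeasurableSet A → MeasurableSet B →
    toFun (A ∪ B) = toFun A + toFun B - toFun A * toFun B
  /-- Countable additivity in the strong operator topology. -/
  hasSum : ∀ A : ℕ → Set Ω, (∀ n, MeasurableSet (A n)) →
    Pairwise (fun i j => Disjoint (A i) (A j)) →
      ∀ x : H, HasSum (fun n => toFun (A n) x) (toFun (⋃ n, A n) x)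

section Integral

variable {Ω : Type*} [MeasurableSpace Ω] {H : Type*} [NormedAddCommGroup H]
  [InnerProductSpace ℂ H]

/-- The integral `∑ c, c • E {s = c}` of a simple function `s` against a spectral measure. -/
noncomputable def SpectralMeasure.simpleIntegral (E : SpectralMeasure Ω H)
    (s : MeasureTheory.SimpleFunc Ω ℂ) : H →L[ℂ] H :=
  ∑ c ∈ s.range, c • E.toFun (s ⁻¹' {c})

/-- `E.HasIntegral f S` says that `S = ∫ f dE` for a bounded measurable function `f`: `f` is the
uniform limit of simple functions whose integrals converge to `S` in operator norm. -/
def SpectralMeasure.HasIntegral (E : SpectralMeasure Ω H) (f : Ω → ℂ) (S : H →L[ℂ] H) : Prop :=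
  ∃ s : ℕ → MeasureTheory.SimpleFunc Ω ℂ,
    TendstoUniformly (fun n z => s n z) f Filter.atTop ∧
      Filter.Tendsto (fun n => E.simpleIntegral (s n)) Filter.atTop (nhds S)

end Integral

section Operators

variable {H : Type*} [NormedAddCommGroup H] [InnerProductSpace ℂ H]

/-- `E` is a spectral resolution of the operator `T`: with `Tₙ = ∫_{|z| ≤ n} z E(dz)`, the domain
of `T` is the set of all `x` for which `lim Tₙ x` exists, and `T x = lim Tₙ x` there. -/
def IsScalarResolution (T : H →ₗ.[ℂ] H) (E : SpectralMeasure ℂ H) : Prop :=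
  ∃ S : ℕ → H →L[ℂ] H,
    (∀ n : ℕ, E.HasIntegral (Set.indicator (Metric.closedBall (0 : ℂ) n) (fun z => z)) (S n)) ∧
    (∀ x : H, x ∈ T.domain ↔ ∃ y, Filter.Tendsto (fun n => S n x) Filter.atTop (nhds y)) ∧
    (∀ x : T.domain, Filter.Tendsto (fun n => S n x) Filter.atTop (nhds (T x)))

/-- A densely defined closed operator is (spectral) of scalar type if it has a spectral
resolution on the Borel sets of the complex plane. -/
def IsScalarType (T : H →ₗ.[ℂ] H) : Prop :=
  Dense (T.domain : Set H) ∧ T.IsClosed ∧ ∃ E : SpectralMeasure ℂ H, IsScalarResolution T E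

/-- A bounded spectral operator of scalar type: the everywhere defined operator given by `U` is
of scalar type. -/
def IsBoundedScalarType (U : H →L[ℂ] H) : Prop :=
  IsScalarType ((U : H →ₗ[ℂ] H).toPMap ⊤)

/-- A para-unitary operator: a bounded spectral operator of scalar type with spectrum in the unit
circle. -/
structure IsParaUnitary (U : H →L[ℂ] H) : Prop where
  isBoundedScalarType : IsBoundedScalarType U
  norm_eq_one : ∀ z ∈ spectrum ℂ U, ‖z‖ = 1

/-- A metric operator: bounded, self-adjoint, strictly positive, with bounded inverse. -/
structure IsMetricOperator [CompleteSpace H] (G : H →L[ℂ] H) : Prop where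
  isSelfAdjoint : IsSelfAdjoint G
  pos : ∀ x : H, x ≠ 0 → 0 < (⟪x, G x⟫_ℂ).re
  isUnit : IsUnit G

end Operators

end ParaUnitary

/-!
The easy direction: if `G ^ (1 / 2) * U * G ^ (-1 / 2)` is unitary, then `U` is similar to a unitary
operator, and similarity preserves the spectrum (`IsMetricOperator.norm_eq_one_of_mem_spectrum`).

For the converse, let `E` be a spectral measure representing the para-unitary operator `U`.

* The functionals `A ↦ ⟪y, E A x⟫` are complex measures, hence of finite total variation. Two uses of
  the uniform boundedness principle turn this into a bound `‖∫ f dE‖ ≤ C * sup |f|` for simple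
  functions `f`, with `C` independent of `f`
  (`SpectralMeasure.exists_norm_simpleCalculus_mul_le`).
* If `w` is in the resolvent set, then `U - w` is bounded below, while on the range of
  `E (ball w r)` its norm is `O(r)`; so `E` vanishes near `w`. By the Lindelöf property `E` is
  concentrated on the spectrum, hence on the unit circle (`toFun_sphere_eq_one`).
* Therefore `U` is a strong limit of integrals of unimodular simple functions. Their positive and
  negative powers are bounded by `C`, which gives `‖x‖ / C ≤ ‖U ^ k x‖ ≤ C * ‖x‖` for all `k`
  (`IsParaUnitary.exists_pow_bounds`).
* As in Sz.-Nagy's theorem on power-bounded operators, a weak limit `G` of the averages of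
  `(U†)ᵏ Uᵏ` is a metric operator with `U† G U = G` (`exists_invariant_metric`), and conjugation by
  `G ^ (1 / 2)` makes `U` isometric. As `0` is not in the spectrum, `U` is invertible, so the
  conjugate is unitary (`IsMetricOperator.conj_mem_unitary`).
-/

namespace ParaUnitary

open MeasureTheory Filter Topology

/-! ### Finite functional calculus of a spectral measure -/

namespace SpectralMeasure

variable {Ω : Type*} [MeasurableSpace Ω] {H : Type*} [NormedAddCommGroup H]
  [InnerProductSpace ℂ H] (E : SpectralMeasure Ω H)

/-- The operator `∫ a ∘ s dE = ∑ c, a c • E {s = c}` for a simple function `s` and an arbitrary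
function `a` of its values. Keeping the partition `{s = c}` fixed while `a` varies makes this an
algebra homomorphism in `a`, so that no common refinements are needed. -/
noncomputable def simpleCalculus (s : SimpleFunc Ω ℂ) (a : ℂ → ℂ) : H →L[ℂ] H :=
  ∑ c ∈ s.range, a c • E.toFun (s ⁻¹' {c})

lemma simpleCalculus_id (s : SimpleFunc Ω ℂ) : E.simpleCalculus s id = E.simpleIntegral s := rfl

lemma simpleCalculus_sub (s : SimpleFunc Ω ℂ) (a b : ℂ → ℂ) :
    E.simpleCalculus s (a - b) = E.simpleCalculus s a - E.simpleCalculus s b := by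
  simp [simpleCalculus, sub_smul, Finset.sum_sub_distrib]

lemma simpleCalculus_smul (s : SimpleFunc Ω ℂ) (r : ℂ) (a : ℂ → ℂ) :
    E.simpleCalculus s (r • a) = r • E.simpleCalculus s a := by
  simp [simpleCalculus, mul_smul, Finset.smul_sum]

lemma toFun_mul_toFun_of_disjoint {A B : Set Ω} (hA : MeasurableSet A) (hB : MeasurableSet B)
    (h : Disjoint A B) : E.toFun A * E.toFun B = 0 := by
  rw [← E.inter A B hA hB, h.inter_eq, E.empty]

lemma toFun_biUnion_finset (F : Finset ℂ) (B : ℂ → Set Ω) (hB : ∀ c, MeasurableSet (B c))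
    (hd : Pairwise (fun i j => Disjoint (B i) (B j))) :
    E.toFun (⋃ c ∈ F, B c) = ∑ c ∈ F, E.toFun (B c) := by
  classical
  induction F using Finset.induction_on with
  | empty => simp [E.empty]
  | insert a F ha ih =>
    have hm : MeasurableSet (⋃ c ∈ F, B c) := F.measurableSet_biUnion fun c _ => hB c
    have hdis : Disjoint (B a) (⋃ c ∈ F, B c) := by
      simp only [Set.disjoint_iUnion_right]
      exact fun c hc => hd fun h => ha (h ▸ hc)
    rw [Finset.set_biUnion_insert, E.union _ _ (hB a) hm,
      E.toFun_mul_toFun_of_disjoint (hB a) hm hdis, sub_zero, ih, Finset.sum_insert ha]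

lemma disjoint_fibers (s : SimpleFunc Ω ℂ) :
    Pairwise (fun c d : ℂ => Disjoint (s ⁻¹' {c}) (s ⁻¹' {d})) := fun _ _ hcd =>
  Disjoint.preimage _ (Set.disjoint_singleton.2 hcd)

lemma simpleCalculus_one (s : SimpleFunc Ω ℂ) : E.simpleCalculus s 1 = 1 := by
  have h : (⋃ c ∈ s.range, s ⁻¹' {c}) = Set.univ := by
    ext z
    simp
  simp only [simpleCalculus, Pi.one_apply, one_smul]
  rw [← E.toFun_biUnion_finset _ _ (fun c => s.measurableSet_preimage _) (disjoint_fibers s), h,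
    E.univ]

lemma simpleCalculus_mul (s : SimpleFunc Ω ℂ) (a b : ℂ → ℂ) :
    E.simpleCalculus s (a * b) = E.simpleCalculus s a * E.simpleCalculus s b := by
  simp only [simpleCalculus, Finset.sum_mul]
  refine Finset.sum_congr rfl fun c hc => ?_
  rw [Finset.mul_sum, Finset.sum_eq_single c]
  · rw [smul_mul_smul_comm, (E.isIdempotentElem _ (s.measurableSet_preimage _)).eq, Pi.mul_apply]
  · intro d _ hd
    rw [smul_mul_smul_comm, E.toFun_mul_toFun_of_disjoint (s.measurableSet_preimage _)
      (s.measurableSet_preimage _) (disjoint_fibers s hd.symm), smul_zero]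
  · exact fun h => (h hc).elim

lemma simpleCalculus_pow (s : SimpleFunc Ω ℂ) (a : ℂ → ℂ) (k : ℕ) :
    E.simpleCalculus s (a ^ k) = E.simpleCalculus s a ^ k := by
  induction k with
  | zero => simpa using E.simpleCalculus_one s
  | succ k ih => rw [pow_succ, simpleCalculus_mul, ih, pow_succ]

lemma simpleCalculus_mul_toFun (s : SimpleFunc Ω ℂ) (a : ℂ → ℂ) {A : Set Ω}
    (hA : MeasurableSet A) :
    E.simpleCalculus s a * E.toFun A = ∑ c ∈ s.range, a c • E.toFun (s ⁻¹' {c} ∩ A) := by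
  simp only [simpleCalculus, Finset.sum_mul, smul_mul_assoc]
  exact Finset.sum_congr rfl fun c _ => by rw [E.inter _ _ (s.measurableSet_preimage _) hA]

/-! ### Uniform boundedness of the calculus -/

open Classical in
/-- The `H`-valued measure `A ↦ E A x`, set to `0` on non-measurable sets as Mathlib's vector
measures require. -/
noncomputable def vectorMeasure (x : H) : VectorMeasure Ω H where
  measureOf' A := if MeasurableSet A then E.toFun A x else 0
  empty' := by simp [E.empty]
  not_measurable' A hA := by simp [hA]
  m_iUnion' A hA hd := by
    simpa [hA, MeasurableSet.iUnion hA] using E.hasSum A hA hd x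

lemma vectorMeasure_apply (x : H) {A : Set Ω} (hA : MeasurableSet A) :
    E.vectorMeasure x A = E.toFun A x :=
  if_pos hA

/-- The signed measure `A ↦ f (E A x)` has finite total variation, which dominates its absolute
sum over any finite partition. -/
lemma exists_sum_abs_le (x : H) (f : H →L[ℝ] ℝ) :
    ∃ K : ℝ, ∀ (s : SimpleFunc Ω ℂ) (A : Set Ω), MeasurableSet A →
      ∑ c ∈ s.range, |f (E.toFun (s ⁻¹' {c} ∩ A) x)| ≤ K := by
  let ν : SignedMeasure Ω := (E.vectorMeasure x).mapRange (f : H →+ ℝ) f.continuous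
  refine ⟨ν.totalVariation.real Set.univ, fun s A hA => ?_⟩
  have hν : ∀ B, MeasurableSet B → ν B = f (E.toFun B x) := fun B hB => by
    rw [show ν B = f (E.vectorMeasure x B) from rfl, E.vectorMeasure_apply x hB]
  calc ∑ c ∈ s.range, |f (E.toFun (s ⁻¹' {c} ∩ A) x)|
      ≤ ∑ c ∈ s.range, ν.totalVariation.real (s ⁻¹' {c}) := by
        refine Finset.sum_le_sum fun c _ => ?_
        rw [← hν _ ((s.measurableSet_preimage _).inter hA), ← Real.norm_eq_abs]
        exact (ν.norm_le_totalVariation _).trans (measureReal_mono Set.inter_subset_left)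
    _ = ν.totalVariation.real Set.univ := by
        rw [measureReal_def, ← s.sum_range_measure_preimage_singleton,
          ENNReal.toReal_sum fun c _ => measure_ne_top _ _]
        rfl

lemma exists_sum_norm_inner_le (x y : H) :
    ∃ K : ℝ, ∀ (s : SimpleFunc Ω ℂ) (A : Set Ω), MeasurableSet A →
      ∑ c ∈ s.range, ‖⟪y, E.toFun (s ⁻¹' {c} ∩ A) x⟫_ℂ‖ ≤ K := by
  obtain ⟨K₁, h₁⟩ := E.exists_sum_abs_le x
    (Complex.reCLM.comp ((innerSL ℂ y).restrictScalars ℝ))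
  obtain ⟨K₂, h₂⟩ := E.exists_sum_abs_le x
    (Complex.imCLM.comp ((innerSL ℂ y).restrictScalars ℝ))
  refine ⟨K₁ + K₂, fun s A hA => ?_⟩
  refine le_trans ?_ (add_le_add (h₁ s A hA) (h₂ s A hA))
  rw [← Finset.sum_add_distrib]
  exact Finset.sum_le_sum fun c _ => Complex.norm_le_abs_re_add_abs_im _

/-- The finite calculus is bounded by a multiple of the supremum of the function, and only the
values on `A` matter after restriction by `E A`. This is the uniform boundedness principle, applied
first to the functionals `⟪T x, ·⟫` and then to the operators `T`. -/
theorem exists_norm_simpleCalculus_mul_le [CompleteSpace H] :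
    ∃ C : ℝ, 0 < C ∧ ∀ (s : SimpleFunc Ω ℂ) (a : ℂ → ℂ) (A : Set Ω) (r : ℝ), MeasurableSet A →
      0 < r → (∀ z ∈ A, ‖a (s z)‖ ≤ r) → ‖E.simpleCalculus s a * E.toFun A‖ ≤ C * r := by
  let ι := {p : SimpleFunc Ω ℂ × (ℂ → ℂ) × Set Ω //
    MeasurableSet p.2.2 ∧ ∀ z ∈ p.2.2, ‖p.2.1 (p.1 z)‖ ≤ 1}
  let T : ι → H →L[ℂ] H := fun p => E.simpleCalculus p.1.1 p.1.2.1 * E.toFun p.1.2.2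
  have key : ∀ x y : H, ∃ K : ℝ, ∀ p : ι, ‖⟪y, T p x⟫_ℂ‖ ≤ K := by
    intro x y
    obtain ⟨K, hK⟩ := E.exists_sum_norm_inner_le x y
    refine ⟨K, ?_⟩
    rintro ⟨⟨s, a, A⟩, hA, ha⟩
    refine le_trans ?_ (hK s A hA)
    simp only [T]
    rw [E.simpleCalculus_mul_toFun s a hA, sum_apply, inner_sum]
    refine (norm_sum_le _ _).trans (Finset.sum_le_sum fun c _ => ?_)
    rw [smul_apply, inner_smul_right, norm_mul]
    rcases (s ⁻¹' {c} ∩ A).eq_empty_or_nonempty with h | ⟨z, hz, hzA⟩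
    · simp [h, E.empty]
    · have : s z = c := hz
      exact mul_le_of_le_one_left (norm_nonneg _) (this ▸ ha z hzA)
  have pointwise : ∀ x : H, ∃ K : ℝ, ∀ p : ι, ‖T p x‖ ≤ K := by
    intro x
    obtain ⟨K, hK⟩ := banach_steinhaus (g := fun p : ι => innerSL ℂ (T p x)) fun y => by
      obtain ⟨K, hK⟩ := key x y
      exact ⟨K, fun p => by rw [innerSL_apply_apply, norm_inner_symm]; exact hK p⟩
    exact ⟨K, fun p => by simpa using hK p⟩
  obtain ⟨C, hC⟩ := banach_steinhaus pointwise
  refine ⟨max C 1, by positivity, fun s a A r hA hr ha => ?_⟩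
  have h1 := hC ⟨(s, (r : ℂ)⁻¹ • a, A), hA, fun z hz => by
    have := ha z hz
    simp only [Pi.smul_apply, smul_eq_mul, norm_mul, norm_inv, Complex.norm_real,
      Real.norm_of_nonneg hr.le]
    rwa [inv_mul_le_iff₀ hr, mul_one]⟩
  simp only [T, E.simpleCalculus_smul, smul_mul_assoc, norm_smul, norm_inv, Complex.norm_real,
    Real.norm_of_nonneg hr.le] at h1
  rw [inv_mul_le_iff₀ hr, mul_comm] at h1
  exact h1.trans (mul_le_mul_of_nonneg_right (le_max_left _ _) hr.le)

/-! ### Null sets -/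

lemma toFun_eq_zero_of_subset {A B : Set Ω} (hA : MeasurableSet A) (hB : MeasurableSet B)
    (h : A ⊆ B) (h0 : E.toFun B = 0) : E.toFun A = 0 := by
  rw [← Set.inter_eq_left.2 h, E.inter A B hA hB, h0, mul_zero]

lemma toFun_iUnion_eq_zero {A : ℕ → Set Ω} (hA : ∀ n, MeasurableSet (A n))
    (h0 : ∀ n, E.toFun (A n) = 0) : E.toFun (⋃ n, A n) = 0 := by
  ext x
  have h := E.hasSum (disjointed A) (fun n => .disjointed hA n)
    (fun i j hij => disjoint_disjointed A hij) x
  have hz : ∀ n, E.toFun (disjointed A n) = 0 := fun n =>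
    E.toFun_eq_zero_of_subset (.disjointed hA n) (hA n) (disjointed_subset A n) (h0 n)
  simp only [hz, iUnion_disjointed] at h
  exact h.unique hasSum_zero

/-- A spectral measure vanishing near every point of an open set vanishes on that set: by the
Lindelöf property countably many of the null neighbourhoods cover it. -/
lemma toFun_eq_zero_of_locally (E : SpectralMeasure ℂ H) {W : Set ℂ} (hW : IsOpen W)
    (h : ∀ z ∈ W, ∃ r > 0, E.toFun (Metric.ball z r) = 0) : E.toFun W = 0 := by
  rcases W.eq_empty_or_nonempty with rfl | ⟨z₀, hz₀⟩
  · exact E.empty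
  choose! r hr h0 using h
  obtain ⟨T, hTc, hT⟩ := TopologicalSpace.isOpen_iUnion_countable
    (fun z : W => Metric.ball (z : ℂ) (r z)) fun _ => Metric.isOpen_ball
  have hcover : W ⊆ ⋃ z ∈ T, Metric.ball (z : ℂ) (r z) := fun z hz => by
    rw [hT]
    exact Set.mem_iUnion.2 ⟨⟨z, hz⟩, Metric.mem_ball_self (hr z hz)⟩
  obtain ⟨z₁, hz₁, -⟩ := Set.mem_iUnion₂.1 (hcover hz₀)
  obtain ⟨f, rfl⟩ := hTc.exists_eq_range ⟨z₁, hz₁⟩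
  rw [Set.biUnion_range] at hcover
  exact E.toFun_eq_zero_of_subset hW.measurableSet
    (MeasurableSet.iUnion fun _ => Metric.isOpen_ball.measurableSet) hcover
    (E.toFun_iUnion_eq_zero (fun _ => Metric.isOpen_ball.measurableSet) fun n => h0 _ (f n).2)

lemma HasIntegral.exists_approx {E : SpectralMeasure Ω H} {f : Ω → ℂ} {S : H →L[ℂ] H}
    (h : E.HasIntegral f S) {ε : ℝ} (hε : 0 < ε) :
    ∃ s : SimpleFunc Ω ℂ, (∀ z, ‖s z - f z‖ < ε) ∧ ‖E.simpleCalculus s id - S‖ < ε := by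
  obtain ⟨s, hs, hS⟩ := h
  obtain ⟨n, h₁, h₂⟩ := ((Metric.tendstoUniformly_iff.1 hs ε hε).and
    (Metric.tendsto_nhds.1 hS ε hε)).exists
  refine ⟨s n, fun z => ?_, by rw [simpleCalculus_id, ← dist_eq_norm]; exact h₂⟩
  rw [← dist_eq_norm, dist_comm]
  exact h₁ z

end SpectralMeasure

/-! ### Operators with a spectral resolution -/

section Resolution

variable {H : Type*} [NormedAddCommGroup H] [InnerProductSpace ℂ H] [CompleteSpace H]

/-- A point of the resolvent set has a neighbourhood on which the spectral measure vanishes: on the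
range of `E (ball w r)` the operator `U - w` is of norm `O(r)`, but it is also bounded below. -/
lemma exists_toFun_ball_eq_zero {U : H →L[ℂ] H} {E : SpectralMeasure ℂ H} {S : ℕ → H →L[ℂ] H}
    (hS : ∀ n : ℕ, E.HasIntegral (Set.indicator (Metric.closedBall (0 : ℂ) n) (fun z => z)) (S n))
    (hlim : ∀ x, Tendsto (fun n => S n x) atTop (𝓝 (U x))) {w : ℂ} (hw : w ∉ spectrum ℂ U) :
    ∃ r > 0, E.toFun (Metric.ball w r) = 0 := by
  obtain ⟨C, hC, hbd⟩ := E.exists_norm_simpleCalculus_mul_le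
  obtain ⟨R, hR⟩ := (spectrum.notMem_iff.1 hw).exists_left_inv
  -- The radius is chosen so that `‖R‖ * (3 * C * r) < 1`.
  set r : ℝ := (4 * C * (‖R‖ + 1))⁻¹ with hr
  have hr0 : 0 < r := by positivity
  have hRr : ‖R‖ * (3 * C * r) < 1 := by
    have : 4 * C * (‖R‖ + 1) * r = 1 := by rw [hr]; field_simp
    have := mul_pos hC hr0
    nlinarith [norm_nonneg R, mul_nonneg (norm_nonneg R) this.le]
  refine ⟨r, hr0, ?_⟩
  set B := Metric.ball w r with hBdef
  have hB : MeasurableSet B := Metric.isOpen_ball.measurableSet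
  obtain ⟨s₀, -⟩ := (hS 0).exists_approx one_pos
  have hEB : ‖E.toFun B‖ ≤ C := by
    have := hbd s₀ 1 B 1 hB one_pos fun z _ => by simp
    rwa [E.simpleCalculus_one, one_mul, mul_one] at this
  have hSm : ∀ m : ℕ, ‖w‖ + r ≤ m → ‖(S m - w • (1 : H →L[ℂ] H)) * E.toFun B‖ ≤ 3 * C * r := by
    intro m hm
    obtain ⟨s, hs, hsS⟩ := (hS m).exists_approx hr0
    have hval : ∀ z ∈ B, ‖(id - w • 1 : ℂ → ℂ) (s z)‖ ≤ 2 * r := by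
      intro z hz
      have hzw : ‖z - w‖ < r := by simpa [hBdef, dist_eq_norm] using hz
      have hzm : z ∈ Metric.closedBall (0 : ℂ) m := by
        rw [mem_closedBall_zero_iff]
        linarith [norm_le_norm_add_norm_sub' z w]
      have h1 := hs z
      rw [Set.indicator_of_mem hzm] at h1
      have h2 : (id - w • 1 : ℂ → ℂ) (s z) = (s z - z) + (z - w) := by simp
      rw [h2]
      linarith [norm_add_le (s z - z) (z - w)]
    have h3 := hbd s _ B (2 * r) hB (by positivity) hval
    rw [E.simpleCalculus_sub, E.simpleCalculus_smul, E.simpleCalculus_one] at h3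
    have h4 : (S m - w • (1 : H →L[ℂ] H)) * E.toFun B =
        (E.simpleCalculus s id - w • (1 : H →L[ℂ] H)) * E.toFun B -
          (E.simpleCalculus s id - S m) * E.toFun B := by
      rw [← sub_mul]; congr 1; abel
    have h5 : ‖(E.simpleCalculus s id - S m) * E.toFun B‖ ≤ r * C :=
      (norm_mul_le _ _).trans (mul_le_mul hsS.le hEB (norm_nonneg _) hr0.le)
    rw [h4]
    linarith [norm_sub_le ((E.simpleCalculus s id - w • (1 : H →L[ℂ] H)) * E.toFun B)
      ((E.simpleCalculus s id - S m) * E.toFun B)]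
  ext x
  set y := E.toFun B x with hy
  have hyy : E.toFun B y = y := DFunLike.congr_fun (E.isIdempotentElem B hB).eq x
  have hUy : ‖U y - w • y‖ ≤ 3 * C * r * ‖y‖ := by
    refine le_of_tendsto ((hlim y).sub_const (w • y)).norm ?_
    filter_upwards [(tendsto_natCast_atTop_atTop (R := ℝ)).eventually_ge_atTop (‖w‖ + r)] with m hm
    have := ContinuousLinearMap.le_of_opNorm_le _ (hSm m hm) y
    simpa [hyy] using this
  have hRy : R (w • y - U y) = y := by
    have := DFunLike.congr_fun hR y
    simpa [Algebra.algebraMap_eq_smul_one] using this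
  have hfin : ‖y‖ ≤ ‖R‖ * (3 * C * r) * ‖y‖ := by
    calc ‖y‖ = ‖R (w • y - U y)‖ := by rw [hRy]
      _ ≤ ‖R‖ * ‖U y - w • y‖ := by rw [norm_sub_rev]; exact R.le_opNorm _
      _ ≤ ‖R‖ * (3 * C * r * ‖y‖) := mul_le_mul_of_nonneg_left hUy (norm_nonneg _)
      _ = _ := by ring
  by_contra hne
  have := norm_pos_iff.2 (show y ≠ 0 from hne)
  nlinarith

/-- If the spectrum lies in the unit circle, then so does the spectral measure. -/
lemma toFun_sphere_eq_one {U : H →L[ℂ] H} {E : SpectralMeasure ℂ H} {S : ℕ → H →L[ℂ] H}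
    (hS : ∀ n : ℕ, E.HasIntegral (Set.indicator (Metric.closedBall (0 : ℂ) n) (fun z => z)) (S n))
    (hlim : ∀ x, Tendsto (fun n => S n x) atTop (𝓝 (U x)))
    (hsp : ∀ z ∈ spectrum ℂ U, ‖z‖ = 1) : E.toFun (Metric.sphere 0 1) = 1 := by
  have h0 : E.toFun (Metric.sphere 0 1)ᶜ = 0 := by
    refine E.toFun_eq_zero_of_locally Metric.isClosed_sphere.isOpen_compl fun z hz => ?_
    exact exists_toFun_ball_eq_zero hS hlim fun hz' => hz (by simpa using hsp z hz')
  rw [E.compl _ Metric.isClosed_sphere.measurableSet, sub_eq_zero] at h0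
  exact h0.symm

lemma norm_normalize_sub_le (c z : ℂ) (hz : ‖z‖ = 1) :
    ‖(if c = 0 then 1 else c / (‖c‖ : ℂ)) - c‖ ≤ ‖c - z‖ := by
  have hle : |1 - ‖c‖| ≤ ‖c - z‖ := by
    rw [← hz, abs_sub_comm]
    exact abs_norm_sub_norm_le c z
  refine le_of_eq_of_le ?_ hle
  split_ifs with hc
  · simp [hc]
  · have hn : (‖c‖ : ℂ) ≠ 0 := by simpa using hc
    rw [show c / (‖c‖ : ℂ) - c = c / ‖c‖ * ((1 - ‖c‖ : ℝ) : ℂ) by push_cast; field_simp,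
      norm_mul, norm_div, Complex.norm_real, Complex.norm_real, norm_norm,
      div_self (norm_ne_zero_iff.2 hc), one_mul, Real.norm_eq_abs]

/-- A bounded scalar-type operator with spectrum in the unit circle is power bounded, and its
positive powers are uniformly bounded below. It is the strong limit of operators `V n` of the finite
calculus whose coefficients are normalized to lie on the circle; for these both bounds hold with a
constant independent of `n` and of the exponent. -/
theorem IsParaUnitary.exists_pow_bounds {U : H →L[ℂ] H} (hU : IsParaUnitary U) :
    ∃ C : ℝ, 0 < C ∧ (∀ (k : ℕ) x, ‖(U ^ k) x‖ ≤ C * ‖x‖) ∧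
      ∀ (k : ℕ) x, ‖x‖ ≤ C * ‖(U ^ k) x‖ := by
  obtain ⟨-, -, E, S, hS, -, hlim'⟩ := hU.isBoundedScalarType
  have hlim : ∀ x, Tendsto (fun n => S n x) atTop (𝓝 (U x)) := fun x => hlim' ⟨x, trivial⟩
  have hE := toFun_sphere_eq_one hS hlim hU.norm_eq_one
  obtain ⟨C, hC, hbd⟩ := E.exists_norm_simpleCalculus_mul_le
  have hbd' : ∀ (s : SimpleFunc ℂ ℂ) (a : ℂ → ℂ) (r : ℝ), 0 < r →
      (∀ z : ℂ, ‖z‖ = 1 → ‖a (s z)‖ ≤ r) → ‖E.simpleCalculus s a‖ ≤ C * r := by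
    intro s a r hr h
    have := hbd s a (Metric.sphere 0 1) r Metric.isClosed_sphere.measurableSet hr fun z hz =>
      h z (by simpa using hz)
    rwa [hE, mul_one] at this
  set g : ℂ → ℂ := fun c => if c = 0 then 1 else c / (‖c‖ : ℂ) with hg
  have hg1 : ∀ c, ‖g c‖ = 1 := by
    intro c
    simp only [hg]
    split_ifs with hc
    · simp
    · rw [norm_div, Complex.norm_real, norm_norm, div_self (norm_ne_zero_iff.2 hc)]
  have hpos : ∀ n : ℕ, 0 < 1 / ((n : ℝ) + 1) := fun n => by positivity
  choose s hs hsS using fun n : ℕ => (hS (n + 1)).exists_approx (hpos n)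
  set V : ℕ → H →L[ℂ] H := fun n => E.simpleCalculus (s n) g with hV
  have hVS : ∀ n, ‖V n - S (n + 1)‖ ≤ (C + 1) * (1 / ((n : ℝ) + 1)) := by
    intro n
    have h1 : ‖E.simpleCalculus (s n) (g - id)‖ ≤ C * (1 / ((n : ℝ) + 1)) := by
      refine hbd' _ _ _ (hpos n) fun z hz => ?_
      have hzn : z ∈ Metric.closedBall (0 : ℂ) ((n + 1 : ℕ) : ℝ) := by
        rw [mem_closedBall_zero_iff, hz]
        push_cast
        linarith [(Nat.cast_nonneg n : (0 : ℝ) ≤ n)]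
      have := hs n z
      rw [Set.indicator_of_mem hzn] at this
      exact (norm_normalize_sub_le (s n z) z hz).trans this.le
    rw [E.simpleCalculus_sub] at h1
    have h2 := norm_sub_le_norm_sub_add_norm_sub (V n) (E.simpleCalculus (s n) id) (S (n + 1))
    linarith [hsS n]
  have hVU : ∀ x, Tendsto (fun n => V n x) atTop (𝓝 (U x)) := by
    intro x
    have h1 : Tendsto (fun n => (V n - S (n + 1)) x) atTop (𝓝 0) := by
      refine squeeze_zero_norm
        (a := fun n : ℕ => (C + 1) * (1 / ((n : ℝ) + 1)) * ‖x‖) (fun n => ?_) ?_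
      · exact ContinuousLinearMap.le_of_opNorm_le _ (hVS n) x
      · simpa using (tendsto_one_div_add_atTop_nhds_zero_nat.const_mul (C + 1)).mul_const ‖x‖
    simpa using h1.add ((hlim x).comp (tendsto_add_atTop_nat 1))
  have hVk : ∀ n k, ‖V n ^ k‖ ≤ C := by
    intro n k
    rw [hV, ← E.simpleCalculus_pow]
    simpa using hbd' (s n) (g ^ k) 1 one_pos fun z _ => by simp [hg1]
  have hVlow : ∀ n k x, ‖x‖ ≤ C * ‖(V n ^ k) x‖ := by
    intro n k x
    have h1 : E.simpleCalculus (s n) (g⁻¹ ^ k) * V n ^ k = 1 := by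
      have hmul : g⁻¹ ^ k * g ^ k = 1 := by
        ext c
        have hne : g c ≠ 0 := norm_ne_zero_iff.1 (by rw [hg1]; exact one_ne_zero)
        simp [hne]
      rw [hV, ← E.simpleCalculus_pow, ← E.simpleCalculus_mul, hmul, E.simpleCalculus_one]
    have h2 : ‖E.simpleCalculus (s n) (g⁻¹ ^ k)‖ ≤ C := by
      simpa using hbd' (s n) (g⁻¹ ^ k) 1 one_pos fun z _ => by simp [hg1]
    calc ‖x‖ = ‖E.simpleCalculus (s n) (g⁻¹ ^ k) ((V n ^ k) x)‖ := by
          rw [← mul_apply_eq_comp, h1, one_apply_eq_self]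
      _ ≤ C * ‖(V n ^ k) x‖ := ContinuousLinearMap.le_of_opNorm_le _ h2 _
  have hVUk : ∀ k x, Tendsto (fun n => (V n ^ k) x) atTop (𝓝 ((U ^ k) x)) := by
    intro k
    induction k with
    | zero => simp
    | succ k ih =>
      intro x
      have h1 : Tendsto (fun n => (V n ^ k) (V n x - U x)) atTop (𝓝 0) := by
        refine squeeze_zero_norm (a := fun n : ℕ => C * ‖V n x - U x‖)
          (fun n => ContinuousLinearMap.le_of_opNorm_le _ (hVk n k) _) ?_
        simpa using (tendsto_iff_norm_sub_tendsto_zero.1 (hVU x)).const_mul C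
      have h2 := h1.add (ih (U x))
      simp only [map_sub, sub_add_cancel, zero_add] at h2
      simpa only [pow_succ, mul_apply_eq_comp] using h2
  exact ⟨C, hC,
    fun k x => le_of_tendsto (hVUk k x).norm
      (Eventually.of_forall fun n => ContinuousLinearMap.le_of_opNorm_le _ (hVk n k) x),
    fun k x => ge_of_tendsto ((hVUk k x).norm.const_mul C)
      (Eventually.of_forall fun n => hVlow n k x)⟩

end Resolution

/-! ### Invariant metrics for power-bounded operators -/

section Averaging

variable {H : Type*} [NormedAddCommGroup H] [InnerProductSpace ℂ H] [CompleteSpace H]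

/-- Weak compactness: a norm-bounded sequence of operators converges weakly along every
ultrafilter. -/
lemma exists_weak_limit (A : ℕ → H →L[ℂ] H) {M : ℝ} (hA : ∀ n, ‖A n‖ ≤ M) (F : Ultrafilter ℕ) :
    ∃ G : H →L[ℂ] H, ∀ x y, Tendsto (fun n => ⟪A n x, y⟫_ℂ) F (𝓝 ⟪G x, y⟫_ℂ) := by
  have hbd : ∀ n x y, ‖⟪A n x, y⟫_ℂ‖ ≤ M * ‖x‖ * ‖y‖ := fun n x y =>
    (norm_inner_le_norm _ _).trans (mul_le_mul_of_nonneg_right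
      ((A n).le_of_opNorm_le (hA n) x) (norm_nonneg y))
  have hlim : ∀ x y, ∃ l : ℂ, ‖l‖ ≤ M * ‖x‖ * ‖y‖ ∧
      Tendsto (fun n => ⟪A n x, y⟫_ℂ) F (𝓝 l) := by
    intro x y
    obtain ⟨l, hl, hle⟩ := (isCompact_closedBall (0 : ℂ) (M * ‖x‖ * ‖y‖)).ultrafilter_le_nhds
      (F.map fun n => ⟪A n x, y⟫_ℂ) (by
        rw [Ultrafilter.coe_map, le_principal_iff, mem_map]
        exact univ_mem' fun n => by simpa using hbd n x y)
    exact ⟨l, by simpa using hl, hle⟩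
  choose L hLn hL using hlim
  let B : H →ₗ⋆[ℂ] H →ₗ[ℂ] ℂ := LinearMap.mk₂'ₛₗ (starRingEnd ℂ) (RingHom.id ℂ) L
    (fun x x' y => tendsto_nhds_unique (hL _ _)
      (((hL x y).add (hL x' y)).congr fun n => by rw [map_add, inner_add_left]))
    (fun c x y => tendsto_nhds_unique (hL _ _)
      (((hL x y).const_mul (starRingEnd ℂ c)).congr fun n => by rw [map_smul, inner_smul_left]))
    (fun x y y' => tendsto_nhds_unique (hL _ _)
      (((hL x y).add (hL x y')).congr fun n => by rw [inner_add_right]))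
    (fun c x y => tendsto_nhds_unique (hL _ _)
      (((hL x y).const_mul c).congr fun n => by rw [inner_smul_right]))
  refine ⟨InnerProductSpace.continuousLinearMapOfBilin (B.mkContinuous₂ M hLn), fun x y => ?_⟩
  rw [InnerProductSpace.continuousLinearMapOfBilin_apply]
  exact hL x y

/-- An operator all of whose positive powers are bounded above and below by the same constants
leaves invariant the inner product `⟪G ·, ·⟫` of some metric operator `G`. Here `G` is a weak limit
along an ultrafilter of the averages of `(U†)ᵏ Uᵏ` for `k ≤ N`. -/
theorem exists_invariant_metric (U : H →L[ℂ] H) {C : ℝ} (hC : 0 < C)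
    (hup : ∀ (k : ℕ) x, ‖(U ^ k) x‖ ≤ C * ‖x‖) (hlow : ∀ (k : ℕ) x, ‖x‖ ≤ C * ‖(U ^ k) x‖) :
    ∃ G : H →L[ℂ] H, IsMetricOperator G ∧ star U * G * U = G := by
  let A : ℕ → H →L[ℂ] H := fun N =>
    ((N : ℂ) + 1)⁻¹ • ∑ k ∈ Finset.range (N + 1), star (U ^ k) * U ^ k
  have hAi : ∀ N x y, ⟪A N x, y⟫_ℂ =
      ((N : ℂ) + 1)⁻¹ * ∑ k ∈ Finset.range (N + 1), ⟪(U ^ k) x, (U ^ k) y⟫_ℂ := by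
    intro N x y
    simp only [A, smul_apply, sum_apply, inner_smul_left,
      sum_inner, mul_apply_eq_comp, ContinuousLinearMap.star_eq_adjoint,
      ContinuousLinearMap.adjoint_inner_left]
    simp
  have hnorm : ∀ N : ℕ, ‖((N : ℂ) + 1)⁻¹‖ = ((N : ℝ) + 1)⁻¹ := fun N => by
    rw [norm_inv, show ((N : ℂ) + 1) = ((N + 1 : ℝ) : ℂ) by push_cast; rfl, Complex.norm_real,
      Real.norm_of_nonneg (by positivity)]
  have hpow : ∀ k : ℕ, ‖U ^ k‖ ≤ C := fun k =>
    ContinuousLinearMap.opNorm_le_bound _ hC.le (hup k)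
  have hAn : ∀ N, ‖A N‖ ≤ C * C := by
    intro N
    have hs : ‖∑ k ∈ Finset.range (N + 1), star (U ^ k) * U ^ k‖ ≤ ((N : ℝ) + 1) * (C * C) := by
      refine (norm_sum_le_of_le _ (f := fun k => star (U ^ k) * U ^ k)
        (n := fun _ => C * C) fun k _ => ?_).trans (by simp)
      refine (norm_mul_le _ _).trans ?_
      rw [norm_star]
      exact mul_le_mul (hpow k) (hpow k) (norm_nonneg _) hC.le
    rw [norm_smul, hnorm, inv_mul_le_iff₀ (by positivity)]
    exact hs
  obtain ⟨G, hG⟩ := exists_weak_limit A hAn (hyperfilter ℕ)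
  have hF : ((hyperfilter ℕ : Ultrafilter ℕ) : Filter ℕ) ≤ atTop := by
    rw [← Nat.cofinite_eq_atTop]
    exact hyperfilter_le_cofinite
  have hsymm : ∀ x y, ⟪G x, y⟫_ℂ = ⟪x, G y⟫_ℂ := by
    intro x y
    rw [← inner_conj_symm x (G y)]
    refine tendsto_nhds_unique (hG x y)
      (((Complex.continuous_conj.tendsto _).comp (hG y x)).congr fun N => ?_)
    simp only [Function.comp_apply, hAi, map_mul, map_sum, inner_conj_symm]
    simp
  have hlower : ∀ x, ‖x‖ ^ 2 * (C ^ 2)⁻¹ ≤ (⟪G x, x⟫_ℂ).re := by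
    intro x
    refine ge_of_tendsto ((Complex.continuous_re.tendsto _).comp (hG x x))
      (Filter.Eventually.of_forall fun N => ?_)
    have hre : (⟪A N x, x⟫_ℂ).re =
        ((N : ℝ) + 1)⁻¹ * ∑ k ∈ Finset.range (N + 1), ‖(U ^ k) x‖ ^ 2 := by
      rw [hAi]
      simp only [inner_self_eq_norm_sq_to_K]
      have : ((N : ℂ) + 1)⁻¹ * ∑ k ∈ Finset.range (N + 1), (Complex.ofReal ‖(U ^ k) x‖) ^ 2 =
        ((((N : ℝ) + 1)⁻¹ * ∑ k ∈ Finset.range (N + 1), ‖(U ^ k) x‖ ^ 2 : ℝ) : ℂ) := by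
        push_cast; rfl
      exact (congrArg Complex.re this).trans (Complex.ofReal_re _)
    rw [Function.comp_apply, hre, ← div_eq_inv_mul, le_div_iff₀ (by positivity)]
    have hterm : ∀ k ∈ Finset.range (N + 1), ‖x‖ ^ 2 * (C ^ 2)⁻¹ ≤ ‖(U ^ k) x‖ ^ 2 := by
      intro k _
      rw [← div_eq_mul_inv, div_le_iff₀ (by positivity), ← mul_pow, mul_comm]
      exact pow_le_pow_left₀ (norm_nonneg _) (hlow k x) 2
    have := Finset.card_nsmul_le_sum _ _ _ hterm
    rw [Finset.card_range, nsmul_eq_mul, Nat.cast_add_one, mul_comm] at this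
    exact this
  refine ⟨G, ⟨?_, ?_, ?_⟩, ?_⟩
  · exact (ContinuousLinearMap.isSelfAdjoint_iff_isSymmetric).2 hsymm
  · intro x hx
    rw [← hsymm]
    exact lt_of_lt_of_le (by have := norm_pos_iff.2 hx; positivity) (hlower x)
  · refine ContinuousLinearMap.isUnit_of_forall_le_norm_inner_map G
      (c := ⟨(C ^ 2)⁻¹, by positivity⟩) (show 0 < (C ^ 2)⁻¹ by positivity) fun x => ?_
    exact (hlower x).trans (Complex.re_le_norm _)
  · ext x
    refine ext_inner_right ℂ fun y => ?_
    rw [mul_apply_eq_comp, mul_apply_eq_comp,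
      ContinuousLinearMap.star_eq_adjoint, ContinuousLinearMap.adjoint_inner_left]
    -- Replacing `(x, y)` by `(U x, U y)` shifts the average by one step, which changes it only
    -- by a bounded quantity divided by `N + 1`.
    have hshift : ∀ N : ℕ, ⟪A N (U x), U y⟫_ℂ - ⟪A N x, y⟫_ℂ =
        ((N : ℂ) + 1)⁻¹ * (⟪(U ^ (N + 1)) x, (U ^ (N + 1)) y⟫_ℂ - ⟪x, y⟫_ℂ) := by
      intro N
      have hU : ∀ (k : ℕ) (v : H), (U ^ k) (U v) = (U ^ (k + 1)) v := fun k v => by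
        rw [pow_succ]; rfl
      rw [hAi, hAi, ← mul_sub, ← Finset.sum_sub_distrib]
      simp only [hU]
      rw [Finset.sum_range_sub (fun k => ⟪(U ^ k) x, (U ^ k) y⟫_ℂ)]
      simp
    have hzero : Tendsto (fun N : ℕ => ⟪A N (U x), U y⟫_ℂ - ⟪A N x, y⟫_ℂ) atTop (𝓝 0) := by
      refine squeeze_zero_norm (a := fun N : ℕ =>
        1 / ((N : ℝ) + 1) * ((C * ‖x‖) * (C * ‖y‖) + ‖x‖ * ‖y‖)) (fun N => ?_) ?_
      · rw [hshift, norm_mul, hnorm, one_div]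
        refine mul_le_mul_of_nonneg_left ((norm_sub_le _ _).trans (add_le_add ?_ ?_))
          (by positivity)
        · exact (norm_inner_le_norm _ _).trans
            (mul_le_mul (hup _ x) (hup _ y) (norm_nonneg _) (by positivity))
        · exact norm_inner_le_norm _ _
      · simpa using tendsto_one_div_add_atTop_nhds_zero_nat.mul_const
          ((C * ‖x‖) * (C * ‖y‖) + ‖x‖ * ‖y‖)
    exact sub_eq_zero.1 (tendsto_nhds_unique ((hG (U x) (U y)).sub (hG x y)) (hzero.mono_left hF))

end Averaging

/-! ### Square roots of metric operators -/

section SquareRoot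

variable {H : Type*} [NormedAddCommGroup H] [InnerProductSpace ℂ H] [CompleteSpace H]

lemma IsMetricOperator.isStrictlyPositive {G : H →L[ℂ] H} (hG : IsMetricOperator G) :
    IsStrictlyPositive G := by
  refine hG.isUnit.isStrictlyPositive ?_
  rw [ContinuousLinearMap.nonneg_iff_isPositive, ContinuousLinearMap.isPositive_def']
  refine ⟨hG.isSelfAdjoint, fun x => ?_⟩
  rw [ContinuousLinearMap.reApplyInnerSelf_apply]
  rcases eq_or_ne x 0 with rfl | hx
  · simp
  · rw [inner_re_symm]
    exact (hG.pos x hx).le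

/-- If `U` preserves the inner product `⟪G ·, ·⟫`, then its conjugate by `G ^ (1 / 2)` preserves
the original one. -/
theorem IsMetricOperator.conj_mem_unitary {G U : H →L[ℂ] H} (hG : IsMetricOperator G)
    (hU : IsUnit U) (h : star U * G * U = G) :
    G ^ (1 / 2 : ℝ) * U * G ^ (-(1 / 2) : ℝ) ∈ unitary (H →L[ℂ] H) := by
  have hp := hG.isStrictlyPositive
  have hPQ := CFC.rpow_mul_rpow_neg (a := G) (1 / 2) hp
  have hQP := CFC.rpow_neg_mul_rpow (a := G) (1 / 2) hp
  have hPP : G ^ (1 / 2 : ℝ) * G ^ (1 / 2 : ℝ) = G := by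
    rw [← CFC.rpow_add hG.isUnit, add_halves, CFC.rpow_one G hp.nonneg]
  have hP : star (G ^ (1 / 2 : ℝ)) = G ^ (1 / 2 : ℝ) :=
    (IsSelfAdjoint.of_nonneg CFC.rpow_nonneg).star_eq
  have hQ : star (G ^ (-(1 / 2) : ℝ)) = G ^ (-(1 / 2) : ℝ) :=
    (IsSelfAdjoint.of_nonneg CFC.rpow_nonneg).star_eq
  have hPu := CFC.isUnit_rpow_iff G (1 / 2) (by norm_num) hp.nonneg |>.2 hG.isUnit
  have hQu := CFC.isUnit_rpow_iff G (-(1 / 2)) (by norm_num) hp.nonneg |>.2 hG.isUnit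
  generalize G ^ (1 / 2 : ℝ) = P at *
  generalize G ^ (-(1 / 2) : ℝ) = Q at *
  have hV : star (P * U * Q) * (P * U * Q) = 1 := by
    calc star (P * U * Q) * (P * U * Q) = Q * (star U * (P * P) * U) * Q := by
          simp only [star_mul, hP, hQ, mul_assoc]
      _ = (Q * P) * (P * Q) := by rw [hPP, h, ← hPP]; simp only [mul_assoc]
      _ = 1 := by rw [hQP, hPQ, one_mul]
  have hVu : IsUnit (P * U * Q) := (hPu.mul hU).mul hQu
  exact Unitary.mem_iff.2 ⟨hV, by rw [← hVu.mul_left_inj, mul_assoc, hV, mul_one, one_mul]⟩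

/-- An operator similar to a unitary one has the same spectrum, hence spectrum in the circle. -/
theorem IsMetricOperator.norm_eq_one_of_mem_spectrum {G U : H →L[ℂ] H} (hG : IsMetricOperator G)
    (h : G ^ (1 / 2 : ℝ) * U * G ^ (-(1 / 2) : ℝ) ∈ unitary (H →L[ℂ] H)) {z : ℂ}
    (hz : z ∈ spectrum ℂ U) : ‖z‖ = 1 := by
  have hp := hG.isStrictlyPositive
  let u : (H →L[ℂ] H)ˣ := ⟨G ^ (1 / 2 : ℝ), G ^ (-(1 / 2) : ℝ),
    CFC.rpow_mul_rpow_neg (a := G) (1 / 2) hp, CFC.rpow_neg_mul_rpow (a := G) (1 / 2) hp⟩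
  have hz' : z ∈ spectrum ℂ ((u : H →L[ℂ] H) * U * ((u⁻¹ : (H →L[ℂ] H)ˣ) : H →L[ℂ] H)) := by
    rwa [spectrum.units_conjugate]
  simpa using spectrum.subset_circle_of_unitary h hz'

end SquareRoot

end ParaUnitary

theorem mainTheorem3 {H : Type*} [NormedAddCommGroup H] [InnerProductSpace ℂ H] [CompleteSpace H]
    [TopologicalSpace.SeparableSpace H] (U : H →L[ℂ] H)
    (hU : ParaUnitary.IsBoundedScalarType U) :
    ParaUnitary.IsParaUnitary U ↔
      ∃ G : H →L[ℂ] H, ParaUnitary.IsMetricOperator G ∧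
        G ^ (1 / 2 : ℝ) * U * G ^ (-(1 / 2) : ℝ) ∈ unitary (H →L[ℂ] H) := by
  constructor
  · intro h
    have hunit : IsUnit U := by
      rw [← spectrum.zero_notMem_iff ℂ]
      exact fun h0 => by simpa using h.norm_eq_one 0 h0
    obtain ⟨C, hC, hup, hlow⟩ := h.exists_pow_bounds
    obtain ⟨G, hG, hinv⟩ := ParaUnitary.exists_invariant_metric U hC hup hlow
    exact ⟨G, hG, hG.conj_mem_unitary hunit hinv⟩
  · rintro ⟨G, hG, h⟩
    exact ⟨hU, fun z hz => hG.norm_eq_one_of_mem_spectrum h hz⟩
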